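/- A poc set is a poset $P$ with a minimum $0$ and an order-reversing involution $a\mapsto a^*$ such that $a\le a^*$ implies $a=0$; elements other than $0,0^*$ are called proper. $P$ is discrete if $\{c : a\le c\le b\}$ is finite for all proper $a,b\in P$. Elements $a,b$ are nested if at least one of $a\le b$, $a^*\le b$, $a\le b^*$, $a^*\le b^*$ holds, and $N\subseteq P$ is nested if its elements are pairwise nested. A non-degenerate weight is a function $w:P\to[0,\infty)$ with $w(0)=0$, $w(a^*)=w(a)$ for all $a$, and $w(a)>0$ for all proper $a$. A complete $*$-selection is a set $U\subseteq P$ containing exactly one of $a,a^*$ for each $a\in P$; it is coherent if there are no $a,b\in U$ with $a\le b^*$. Let $P^\circ$ be the set of coherent complete $*$-selections, viewed as a graph in which $U,V$ are adjacent iff $|U\smallsetminus V|=1$. Fix $B\in P^\circ$. Represent a complete $*$-selection $U$ by the vertex $\rho(U)=\chi_{B\smallsetminus U}$ of the cube $[0,1]^B$, so that $\rho(B)=0$. The weighted dual $C^w(P)_B\subseteq\mathbb{R}^B$ is the union of its cubes, which are the images under $t\mapsto wt$ (pointwise product) of those finite-dimensional faces of $[0,1]^B$ all of whose vertices are of the form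 $\rho(V)$ with $V$ in the connected component of $B$ in $P^\circ$. Let $\ell^\infty_w$ be the quotient distance on $C^w(P)_B$ obtained by giving each cube the metric induced by $\|\cdot\|_\infty$, that is, the infimum of $\sum_{i=1}^n\|x_i-x_{i-1}\|_\infty$ over finite sequences $x=x_0,\dots,x_n=y$ in $C^w(P)_B$ in which any two consecutive points lie in a common cube. For $x\in C^w(P)_B$ and $a\in P\smallsetminus B$ write $x(a):=x(a^*)$, and let the separator $x\smallsetminus y$ be the set of all $a\in P$ such that either $a\in B$ and $x(a)<y(a)$, or $a^*\in B$ and $x(a)>y(a)$. **Proposition.** Let $P$ be a discrete poc set with non-degenerate weight $w$ and basepoint $B\in P^\circ$. Then for any $x,y\in C^w(P)_B$ the distance $\ell^\infty_w(x,y)$ is finite and $$\ell^\infty_w(x,y)=\max\Big\{\sum_{a\in N}|x(a)-y(a)| \;:\; N\text{ is a nested subset of }x\smallsetminus y\Big\};$$ in particular the maximum is attained. -/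

import Mathlib

open scoped ENNReal

/-- A poc set: a poset with a minimum `⊥`, endowed with an order-reversing involution
`a ↦ aᶜ` such that `a ≤ aᶜ` only for `a = ⊥`. -/
class PocSet (P : Type*) extends PartialOrder P, OrderBot P, Compl P where
  compl_involutive : ∀ a : P, aᶜᶜ = a
  compl_antitone : ∀ a b : P, a ≤ b → bᶜ ≤ aᶜ
  eq_bot_of_le_compl : ∀ a : P, a ≤ aᶜ → a = ⊥

namespace PocSet

section Basic

variable {P : Type*} [PocSet P]

/-- The proper elements: those other than the minimum and its complement. -/
def IsProper (a : P) : Prop := a ≠ ⊥ ∧ a ≠ (⊥ : P)ᶜ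

/-- Two elements are nested if one of the four nesting relations holds. -/
def NestedPair (a b : P) : Prop := a ≤ b ∨ aᶜ ≤ b ∨ a ≤ bᶜ ∨ aᶜ ≤ bᶜ

/-- A set is nested if its elements are pairwise nested. -/
def IsNested (N : Set P) : Prop := ∀ a ∈ N, ∀ b ∈ N, NestedPair a b

/-- A complete selection: exactly one of `a`, `aᶜ` is selected, for every `a`. -/
def IsSelection (U : Set P) : Prop := ∀ a : P, Xor (a ∈ U) (aᶜ ∈ U)

/-- A set is coherent if it has no elements `a`, `b` with `a ≤ bᶜ`. -/
def IsCoherent (U : Set P) : Prop := ∀ a ∈ U, ∀ b ∈ U, ¬ a ≤ bᶜ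

theorem IsSelection.compl_mem_iff {U : Set P} (hU : IsSelection U) (a : P) :
    aᶜ ∈ U ↔ a ∉ U := by
  rcases hU a with h | h
  · exact ⟨fun h' => absurd h' h.2, fun h' => absurd h.1 h'⟩
  · exact ⟨fun _ => h.2, fun _ => h.1⟩

/-- A weight: a nonnegative function vanishing at `⊥` and invariant under complementation. -/
structure IsWeight (w : P → ℝ) : Prop where
  nonneg : ∀ a, 0 ≤ w a
  map_bot : w ⊥ = 0
  map_compl : ∀ a, w aᶜ = w a

/-- A weight is non-degenerate if it is positive on proper elements. -/
def IsNondegenerate (w : P → ℝ) : Prop := ∀ a, IsProper a → 0 < w a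

end Basic

/-- A poc set is discrete if the order intervals between its proper elements are finite. -/
def IsDiscrete (P : Type*) [PocSet P] : Prop :=
  ∀ a b : P, IsProper a → IsProper b → (Set.Icc a b).Finite

/-- The ultrafilters on a poc set: the coherent complete selections. They are the vertices of the
dual cube complex. -/
def Dual (P : Type*) [PocSet P] : Type _ :=
  {U : Set P // IsSelection U ∧ IsCoherent U}

/-- The 1-skeleton of the dual cube complex: `U` and `V` are adjacent if `U \ V` is a singleton. -/
def dualGraph (P : Type*) [PocSet P] : SimpleGraph (Dual P) where
  Adj U V := (U.1 \ V.1).ncard = 1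
  symm := ⟨by
    intro U V h
    have key : V.1 \ U.1 = (fun a : P => aᶜ) '' (U.1 \ V.1) := by
      ext a
      constructor
      · rintro ⟨h1, h2⟩
        refine ⟨aᶜ, ⟨(U.2.1.compl_mem_iff a).2 h2, fun h3 => ?_⟩, compl_involutive a⟩
        exact (V.2.1.compl_mem_iff a).1 h3 h1
      · rintro ⟨b, ⟨h1, h2⟩, rfl⟩
        exact ⟨(V.2.1.compl_mem_iff b).2 h2, fun h3 => (U.2.1.compl_mem_iff b).1 h3 h1⟩
    have inj : Function.Injective (fun a : P => aᶜ) :=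
      Function.LeftInverse.injective compl_involutive
    rw [key, Set.ncard_image_of_injective _ inj]
    exact h⟩
  loopless := ⟨by
    intro U h
    simp at h⟩

end PocSet

/-- The quotient (semi-)distance on a set `Y` of classes, the class of a point of `X` being given
by `π`: the greatest lower bound of the sums `∑ i ≤ n, d (p i) (q i)` over the chains with `p 0` in
the class `ξ`, `q n` in the class `η`, and `q i`, `p (i + 1)` always in the same class. -/
noncomputable def quotientEDist {X Y : Type*} (d : X → X → ℝ≥0∞) (π : X → Y) (ξ η : Y) : ℝ≥0∞ :=
  sInf {s | ∃ (n : ℕ) (p q : ℕ → X), π (p 0) = ξ ∧ π (q n) = η ∧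
    (∀ i < n, π (q i) = π (p (i + 1))) ∧ s = ∑ i ∈ Finset.range (n + 1), d (p i) (q i)}

namespace PocSet

section Realization

variable {P : Type*} [PocSet P]

open Classical in
/-- The vertex of the standard cube `[0,1]^B` that represents a complete selection `U`: the
indicator function of `B \ U`. The basepoint `B` itself is sent to the origin. -/
noncomputable def rho (B : Dual P) (U : Set P) : B.1 → ℝ :=
  fun b => if (b : P) ∈ U then 0 else 1

/-- The vertices (complete selections) of the face of the cube `[0,1]^B` that contains `U` and has
the finite set `F` of free coordinates. -/
def faceVertices (B : Dual P) (U : Set P) (F : Finset B.1) : Set (Set P) :=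
  {V | IsSelection V ∧ ∀ b : B.1, b ∉ F → ((b : P) ∈ V ↔ (b : P) ∈ U)}

/-- The face of the standard cube `[0,1]^B` that contains the vertex `rho B U` and has the finite
set `F` of free coordinates. -/
def unitFace (B : Dual P) (U : Set P) (F : Finset B.1) : Set (B.1 → ℝ) :=
  {t | (∀ b, t b ∈ Set.Icc (0 : ℝ) 1) ∧ ∀ b, b ∉ F → t b = rho B U b}

/-- The pointwise product with the weight. -/
def diag (w : P → ℝ) (B : Dual P) (t : B.1 → ℝ) : B.1 → ℝ := fun b => w b * t b

/-- The cubes of the weighted dual: the images under `diag w B` of the (finite-dimensional) faces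
of `[0,1]^B` all of whose vertices are coherent and lie in the component of the basepoint `B`. -/
def weightedCubes (w : P → ℝ) (B : Dual P) : Set (Set (B.1 → ℝ)) :=
  {Q | ∃ (U : Set P) (F : Finset B.1), IsSelection U ∧
    (∀ V ∈ faceVertices B U F, ∃ hV : IsSelection V ∧ IsCoherent V,
      (dualGraph P).Reachable B ⟨V, hV⟩) ∧
    Q = diag w B '' unitFace B U F}

/-- The weighted dual of `P` with weight `w` and basepoint `B`: the union of its cubes. -/
def weightedDual (w : P → ℝ) (B : Dual P) : Set (B.1 → ℝ) := ⋃₀ weightedCubes w B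

open Classical in
/-- The distance on the disjoint union of the cubes: the supremum distance inside each cube, and
`∞` between points of distinct cubes. -/
noncomputable def cubeEDist (w : P → ℝ) (B : Dual P)
    (p q : Σ Q : weightedCubes w B, Q.1) : ℝ≥0∞ :=
  if p.1 = q.1 then ⨆ b : B.1, ENNReal.ofReal |(p.2 : B.1 → ℝ) b - (q.2 : B.1 → ℝ) b| else ⊤

/-- The piecewise-`ℓ^∞` distance on the weighted dual: the quotient distance obtained from the
disjoint union of the cubes by identifying the points of the cubes that coincide. -/
noncomputable def ellInfty (w : P → ℝ) (B : Dual P) (x y : B.1 → ℝ) : ℝ≥0∞ :=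
  quotientEDist (cubeEDist w B) (fun p => (p.2 : B.1 → ℝ)) x y

open Classical in
/-- The coordinate `x(a)` for an arbitrary `a : P`: the coordinate that corresponds to the element
of `{a, aᶜ}` that lies in `B`. -/
noncomputable def coord (B : Dual P) (x : B.1 → ℝ) (a : P) : ℝ :=
  if h : a ∈ B.1 then x ⟨a, h⟩ else x ⟨aᶜ, (B.2.1.compl_mem_iff a).2 h⟩

/-- The separator `x \ y`. -/
def separator (B : Dual P) (x y : B.1 → ℝ) : Set P :=
  {a | (a ∈ B.1 ∧ coord B x a < coord B y a) ∨ (aᶜ ∈ B.1 ∧ coord B x a > coord B y a)}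

end Realization

end PocSet

/-! Lower bound: for nested `N` without complementary pairs, `∑ a ∈ N, |x(a) - y(a)|` satisfies the
triangle inequality. Inside one cube the varying coordinates are pairwise transverse, so at most one
term is nonzero and the sum is at most the sup distance. Hence it is below the quotient distance
(`tsum_le_ellInfty`).

Upper bound: encode a point as shares `X a + X aᶜ = w a`, with `X a = 0` or `X c = w c` whenever `a
< c` (`IsState`). To go from `X` to `Y`, move the same mass `ε` out of every minimal element of the
finite set `{Y < X}`, where `ε` is the least excess `X - Y` among them. The move stays in a cube
(`shift_minimal`, `exists_common_cube`), costs at most `ε` and removes an element from the set. By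
induction the rest of the path is bounded by the excess along a chain; this chain contains a minimal
element, which has lost `ε`, or extends downwards by one, whose excess is at least `ε`
(`exists_chain_ellInfty_le`). Chains are nested, so the bounds meet and a finite chain attains the
maximum. -/

theorem quotientEDist_le_add {X Y : Type*} (d : X → X → ℝ≥0∞) (π : X → Y) (p q : X) (η : Y) :
    quotientEDist d π (π p) η ≤ d p q + quotientEDist d π (π q) η := by
  unfold quotientEDist
  rw [ENNReal.add_sInf]
  refine le_iInf₂ ?_
  rintro s ⟨n, p', q', h0, hn, hstep, rfl⟩
  refine sInf_le ⟨n + 1, fun i => Nat.casesOn i p p', fun i => Nat.casesOn i q q', rfl, hn, ?_, ?_⟩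
  · rintro (_ | i) hi
    · exact h0.symm
    · exact hstep i (by omega)
  · rw [Finset.sum_range_succ' _ (n + 1), add_comm]
    rfl

/-- Telescoping along chains: the quotient distance dominates every function with the triangle
inequality that is dominated by `d`. -/
theorem le_quotientEDist {X Y : Type*} {d : X → X → ℝ≥0∞} {π : X → Y} {D : Y → Y → ℝ≥0∞}
    (htri : ∀ ξ η ζ, D ξ ζ ≤ D ξ η + D η ζ) (hd : ∀ p q, D (π p) (π q) ≤ d p q) (ξ η : Y) :
    D ξ η ≤ quotientEDist d π ξ η := by
  refine le_sInf ?_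
  rintro s ⟨n, p, q, rfl, rfl, hstep, rfl⟩
  induction n with
  | zero => simpa using hd (p 0) (q 0)
  | succ n ih =>
    rw [Finset.sum_range_succ]
    refine (htri _ (π (q n)) _).trans (add_le_add (ih fun i hi => hstep i (by omega)) ?_)
    rw [hstep n (by omega)]
    exact hd _ _

namespace PocSet

/-! ### Poc sets and ultrafilters -/

section PocSetLemmas

variable {P : Type*} [PocSet P]

theorem compl_inj' {a b : P} (h : aᶜ = bᶜ) : a = b := by
  rw [← compl_involutive a, h, compl_involutive]

theorem le_compl_comm' {a b : P} (h : a ≤ bᶜ) : b ≤ aᶜ := by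
  have := compl_antitone _ _ h
  rwa [compl_involutive] at this

theorem compl_lt_compl' {a b : P} (h : a < b) : bᶜ < aᶜ :=
  lt_of_le_of_ne (compl_antitone _ _ h.le) fun e => h.ne (compl_inj' e).symm

theorem IsCoherent.bot_notMem {U : Set P} (hU : IsCoherent U) : ⊥ ∉ U :=
  fun h => hU ⊥ h ⊥ h bot_le

theorem IsCoherent.mem_of_le {U : Set P} (hU : IsCoherent U) (hs : IsSelection U) {a b : P}
    (h : a ≤ b) (ha : a ∈ U) : b ∈ U := by
  by_contra hb
  exact hU a ha bᶜ ((hs.compl_mem_iff b).2 hb) (by rwa [compl_involutive])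

theorem Dual.compl_mem_iff (B : Dual P) (a : P) : aᶜ ∈ B.1 ↔ a ∉ B.1 := B.2.1.compl_mem_iff a

theorem Dual.bot_ne_top (B : Dual P) : (⊥ : P) ≠ ⊥ᶜ := fun h =>
  B.2.2.bot_notMem (h ▸ (B.compl_mem_iff ⊥).2 B.2.2.bot_notMem)

theorem Dual.ne_compl (B : Dual P) (a : P) : a ≠ aᶜ := fun h => by
  have := B.compl_mem_iff a
  rw [← h] at this
  tauto

theorem Dual.ext_of_subset {U V : Dual P} (h : U.1 ⊆ V.1) : U = V := by
  refine Subtype.ext (h.antisymm fun a ha => ?_)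
  by_contra hU
  exact (V.compl_mem_iff a).1 (h ((U.compl_mem_iff a).2 hU)) ha

end PocSetLemmas

/-! ### Components of the dual graph -/

section Graph

variable {P : Type*} [PocSet P]

/-- Flipping a minimal element of an ultrafilter. -/
theorem exists_flip (U : Dual P) {a : P} (ha : a ∈ U.1) (htop : a ≠ (⊥ : P)ᶜ)
    (hmin : ∀ b ∈ U.1, b ≤ a → b = a) : ∃ V : Dual P, ∀ b, b ∈ V.1 ↔ (b ∈ U.1 ∧ b ≠ a) ∨ b = aᶜ := by
  have hne := U.ne_compl a
  have hac : aᶜ ∉ U.1 := fun h => (U.compl_mem_iff a).1 h ha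
  refine ⟨⟨{b | (b ∈ U.1 ∧ b ≠ a) ∨ b = aᶜ}, fun b => ?_, ?_⟩, fun b => Iff.rfl⟩
  · have h1 := U.compl_mem_iff b
    have h2 : bᶜ = aᶜ ↔ b = a := ⟨compl_inj', fun h => by rw [h]⟩
    have h3 : bᶜ = a ↔ b = aᶜ :=
      ⟨fun h => by rw [← h, compl_involutive], fun h => by rw [h, compl_involutive]⟩
    simp only [Set.mem_ofPred_eq, Xor, h1, h2, h3, ne_eq]
    by_cases hb : b = a
    · subst hb; simp [ha, hne]
    · by_cases hb' : b = aᶜ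
      · subst hb'; simp [hb]
      · simp [hb, hb']; tauto
  · rintro b (⟨hb, hba⟩ | rfl) c (⟨hc, hca⟩ | rfl) hbc
    · exact U.2.2 b hb c hc hbc
    · rw [compl_involutive] at hbc
      exact hba (hmin b hb hbc)
    · have := le_compl_comm' hbc
      rw [compl_involutive] at this
      exact hca (hmin c hc this)
    · rw [compl_involutive] at hbc
      have h0 : aᶜ = ⊥ := eq_bot_of_le_compl _ (by rwa [compl_involutive])
      exact htop (by rw [← h0, compl_involutive])

/-- A minimal element of `U \ V` is minimal in all of `U`, because `V` is upward closed; flipping it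
brings `U` one step closer to `V`. -/
theorem reachable_of_finite (U V : Dual P) (h : (U.1 \ V.1).Finite) :
    (dualGraph P).Reachable U V := by
  induction hk : (U.1 \ V.1).ncard generalizing U with
  | zero =>
    rw [Set.ncard_eq_zero h, Set.sdiff_eq_empty] at hk
    rw [Dual.ext_of_subset hk]
  | succ k ih =>
    have hne : (U.1 \ V.1).Nonempty := by
      rw [← Set.ncard_pos h]; omega
    obtain ⟨a, ha⟩ := h.exists_minimal hne
    have hmin : ∀ b ∈ U.1, b ≤ a → b = a := fun b hb hba =>
      hba.antisymm (ha.2 ⟨hb, fun hbV => ha.1.2 (V.2.2.mem_of_le V.2.1 hba hbV)⟩ hba)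
    have htop : a ≠ (⊥ : P)ᶜ := fun h =>
      ha.1.2 (h ▸ (V.compl_mem_iff ⊥).2 V.2.2.bot_notMem)
    obtain ⟨W, hW⟩ := exists_flip U ha.1.1 htop hmin
    have h1 : U.1 \ W.1 = {a} := by
      ext b
      simp only [Set.mem_sdiff, hW, Set.mem_singleton_iff]
      constructor
      · tauto
      · rintro rfl
        exact ⟨ha.1.1, by have := U.ne_compl b; tauto⟩
    have h2 : W.1 \ V.1 = (U.1 \ V.1) \ {a} := by
      ext b
      have := (V.compl_mem_iff a).2 ha.1.2
      simp only [Set.mem_sdiff, hW, Set.mem_singleton_iff]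
      constructor
      · rintro ⟨h | rfl, h'⟩ <;> tauto
      · tauto
    have hadj : (dualGraph P).Adj U W := by
      change (U.1 \ W.1).ncard = 1
      rw [h1, Set.ncard_singleton]
    refine hadj.reachable.trans (ih W (h2 ▸ h.sdiff) ?_)
    rw [h2, Set.ncard_sdiff_singleton_of_mem ha.1, hk]
    omega

theorem finite_of_reachable {U V : Dual P} (h : (dualGraph P).Reachable U V) :
    (U.1 \ V.1).Finite := by
  obtain ⟨p⟩ := h
  induction p with
  | nil => simp
  | cons hadj _ ih =>
    refine ((Set.finite_of_ncard_pos (by rw [show Set.ncard _ = 1 from hadj]; omega)).union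
      ih).subset ?_
    · intro a ha
      simp only [Set.mem_union, Set.mem_sdiff] at ha ⊢
      tauto

end Graph

/-! ### Vertices of faces and transversality -/

section Faces

variable {P : Type*} [PocSet P]

/-- The complete selection that agrees with `T` on the basepoint. -/
def selectionOf (B : Dual P) (T : Set P) : Set P :=
  {a | (a ∈ B.1 ∧ a ∈ T) ∨ (a ∉ B.1 ∧ aᶜ ∉ T)}

theorem isSelection_selectionOf (B : Dual P) (T : Set P) : IsSelection (selectionOf B T) := by
  intro a
  have := B.compl_mem_iff a
  simp only [selectionOf, Xor, Set.mem_ofPred_eq, this, compl_involutive]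
  tauto

theorem mem_selectionOf {B : Dual P} {T : Set P} {b : P} (hb : b ∈ B.1) :
    b ∈ selectionOf B T ↔ b ∈ T := by
  simp [selectionOf, hb]

/-- `a` or its complement is one of the free coordinates. -/
def IsFree (B : Dual P) (F : Finset B.1) (a : P) : Prop := ∃ b ∈ F, (b : P) = a ∨ (b : P) = aᶜ

theorem IsFree.compl {B : Dual P} {F : Finset B.1} {a : P} (h : IsFree B F a) :
    IsFree B F aᶜ := by
  obtain ⟨b, hb, h | h⟩ := h
  · exact ⟨b, hb, Or.inr (by rw [compl_involutive, h])⟩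
  · exact ⟨b, hb, Or.inl h⟩

/-- Free coordinates can be chosen independently, so only `c = aᶜ` could prevent a common vertex. -/
theorem exists_faceVertex {B : Dual P} {U : Set P} (hU : IsSelection U) {F : Finset B.1} {a c : P}
    (ha : a ∈ U ∨ IsFree B F a) (hc : c ∈ U ∨ IsFree B F c) (hac : c ≠ aᶜ) :
    ∃ V ∈ faceVertices B U F, a ∈ V ∧ c ∈ V := by
  classical
  have hne := B.ne_compl
  have hac' : a ≠ cᶜ := fun h => hac (by rw [h, compl_involutive])
  set T : Set P := {b | if IsFree B F b then b = a ∨ b = c else b ∈ U} with hT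
  have key : ∀ e d : P, (∀ b, (b = e ∨ b = d) ↔ (b = a ∨ b = c)) → d ≠ eᶜ →
      (e ∈ U ∨ IsFree B F e) → e ∈ selectionOf B T := by
    intro e d hed hde he
    by_cases heB : e ∈ B.1
    · rw [mem_selectionOf heB]
      simp only [hT, Set.mem_ofPred_eq]
      split_ifs with hf
      · exact (hed e).1 (Or.inl rfl)
      · tauto
    · refine Or.inr ⟨heB, ?_⟩
      simp only [hT, Set.mem_ofPred_eq]
      split_ifs with hf
      · rw [← hed]
        rintro (h | h)
        · exact hne e h.symm
        · exact hde h.symm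
      · have hf' : ¬ IsFree B F e := fun h => hf h.compl
        rw [hU.compl_mem_iff]
        tauto
  refine ⟨selectionOf B T, ⟨isSelection_selectionOf B T, fun b hb => ?_⟩,
    key a c (fun b => Iff.rfl) hac ha, key c a (fun b => or_comm) hac' hc⟩
  rw [mem_selectionOf b.2]
  have : ¬ IsFree B F b := by
    rintro ⟨b', hb', h | h⟩
    · exact hb (Subtype.ext h ▸ hb')
    · exact (B.compl_mem_iff b).1 (h ▸ b'.2) b.2
  simp [hT, this]

/-- The elements that are free in a cube of coherent vertices are transverse. -/
theorem not_nestedPair_of_isFree {B : Dual P} {U : Set P} (hU : IsSelection U) {F : Finset B.1}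
    (hcoh : ∀ V ∈ faceVertices B U F, IsCoherent V) {a c : P} (ha : IsFree B F a)
    (hc : IsFree B F c) (h1 : c ≠ a) (h2 : c ≠ aᶜ) : ¬ NestedPair a c := by
  -- Freeness is invariant under complements, so all four nesting relations reduce to this one.
  have key : ∀ a c : P, IsFree B F a → IsFree B F c → c ≠ aᶜ → ¬ a ≤ cᶜ := by
    intro a c ha hc hac hle
    obtain ⟨V, hV, haV, hcV⟩ := exists_faceVertex hU (Or.inr ha) (Or.inr hc) hac
    exact hcoh V hV a haV c hcV hle
  have h3 : cᶜ ≠ a := fun h => h2 (by rw [← h, compl_involutive])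
  rintro (h | h | h | h)
  · exact key a cᶜ ha hc.compl (fun e => h1 (compl_inj' e)) (by rwa [compl_involutive])
  · exact key aᶜ cᶜ ha.compl hc.compl (by rwa [compl_involutive]) (by rwa [compl_involutive])
  · exact key a c ha hc h2 h
  · exact key aᶜ c ha.compl hc (by rwa [compl_involutive]) h

end Faces

/-! ### Points as distributions of mass -/

section Mass

variable {P : Type*} [PocSet P]

open Classical in
/-- The share of `a` in the point `x`: it is `w a` if `x` is on the side of `a`, and `0` if `x` is
on the side of `aᶜ`. -/
noncomputable def mass (w : P → ℝ) (B : Dual P) (x : B.1 → ℝ) (a : P) : ℝ :=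
  if h : a ∈ B.1 then w a - x ⟨a, h⟩ else x ⟨aᶜ, (B.2.1.compl_mem_iff a).2 h⟩

/-- The point with given shares. -/
def ofMass (B : Dual P) (X : P → ℝ) : B.1 → ℝ := fun b => X (b : P)ᶜ

theorem mass_compl_coe (w : P → ℝ) (B : Dual P) (x : B.1 → ℝ) (b : B.1) :
    mass w B x (b : P)ᶜ = x b := by
  have : (b : P)ᶜ ∉ B.1 := fun h => (B.compl_mem_iff _).1 h b.2
  simp [mass, this, compl_involutive]

theorem ofMass_mass (w : P → ℝ) (B : Dual P) (x : B.1 → ℝ) : ofMass B (mass w B x) = x :=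
  funext fun b => mass_compl_coe w B x b

theorem mass_of_mem (w : P → ℝ) {B : Dual P} (x : B.1 → ℝ) {a : P} (h : a ∈ B.1) :
    mass w B x a = w a - x ⟨a, h⟩ := by simp [mass, h]

theorem abs_coord_sub_coord (w : P → ℝ) (B : Dual P) (x y : B.1 → ℝ) (a : P) :
    |coord B x a - coord B y a| = |mass w B x a - mass w B y a| := by
  by_cases h : a ∈ B.1
  · simp only [coord, mass, h, dif_pos]
    rw [abs_sub_comm]
    congr 1
    ring
  · simp [coord, mass, h]

theorem separator_eq (w : P → ℝ) (B : Dual P) (x y : B.1 → ℝ) :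
    separator B x y = {a | mass w B y a < mass w B x a} := by
  ext a
  by_cases h : a ∈ B.1
  · simp [separator, coord, mass, h, B.compl_mem_iff]
  · simp [separator, coord, mass, h, B.compl_mem_iff]

/-- The functions on `P` that arise as shares of the points of the weighted dual. -/
structure IsState (w : P → ℝ) (B : Dual P) (X : P → ℝ) : Prop where
  add_compl : ∀ a, X a + X aᶜ = w a
  nonneg : ∀ a, 0 ≤ X a
  finite : {b | b ∈ B.1 ∧ X bᶜ ≠ 0}.Finite
  coherent : ∀ a c, a < c → X a = 0 ∨ X c = w c

theorem exists_isFree_or_mem {w : P → ℝ} {B : Dual P} {U : Set P} (hU : IsSelection U)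
    {F : Finset B.1} {x : B.1 → ℝ} (hx : x ∈ diag w B '' unitFace B U F) {a : P}
    (ha : mass w B x a ≠ 0) : a ∈ U ∨ IsFree B F a := by
  obtain ⟨t, ht, rfl⟩ := hx
  by_contra! hcon
  refine ha ?_
  by_cases h : a ∈ B.1
  · have h1 := ht.2 ⟨a, h⟩ fun hF => hcon.2 ⟨_, hF, Or.inl rfl⟩
    simp [mass, h, diag, h1, rho, hcon.1]
  · have hc := (B.compl_mem_iff a).2 h
    have h1 := ht.2 ⟨aᶜ, hc⟩ fun hF => hcon.2 ⟨_, hF, Or.inr rfl⟩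
    simp [mass, h, diag, h1, rho, (hU.compl_mem_iff a).2 hcon.1]

theorem isFree_of_mass_ne {w : P → ℝ} {B : Dual P} {U : Set P}
    {F : Finset B.1} {x y : B.1 → ℝ} (hx : x ∈ diag w B '' unitFace B U F)
    (hy : y ∈ diag w B '' unitFace B U F) {a : P}
    (ha : mass w B x a ≠ mass w B y a) : IsFree B F a := by
  obtain ⟨t, ht, rfl⟩ := hx
  obtain ⟨s, hs, rfl⟩ := hy
  by_contra hcon
  refine ha ?_
  by_cases h : a ∈ B.1
  · have h1 : (⟨a, h⟩ : B.1) ∉ F := fun hF => hcon ⟨_, hF, Or.inl rfl⟩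
    simp [mass, h, diag, ht.2 _ h1, hs.2 _ h1]
  · have h1 : (⟨aᶜ, (B.compl_mem_iff a).2 h⟩ : B.1) ∉ F := fun hF => hcon ⟨_, hF, Or.inr rfl⟩
    simp [mass, h, diag, ht.2 _ h1, hs.2 _ h1]

theorem mass_add_mass_compl {w : P → ℝ} (hw : IsWeight w) (B : Dual P) (x : B.1 → ℝ) (a : P) :
    mass w B x a + mass w B x aᶜ = w a := by
  by_cases h : a ∈ B.1
  · rw [mass_of_mem w x h, mass_compl_coe w B x ⟨a, h⟩]
    ring
  · have hc := (B.compl_mem_iff a).2 h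
    have := mass_compl_coe w B x ⟨aᶜ, hc⟩
    simp only [compl_involutive] at this
    rw [mass_of_mem w x hc, this, hw.map_compl]
    ring

/-- If `a < c` and both `a` and `cᶜ` had nonzero share, some vertex of the cube would contain both
and be incoherent. Finiteness holds because a vertex differs from `B` finitely often and the cube
has finite dimension. -/
theorem isState_mass {w : P → ℝ} (hw : IsWeight w) {B : Dual P} {x : B.1 → ℝ}
    (hx : x ∈ weightedDual w B) : IsState w B (mass w B x) := by
  obtain ⟨_, ⟨U, F, hU, hV, rfl⟩, hx⟩ := hx
  have hbd : ∀ b, 0 ≤ x b ∧ x b ≤ w b := by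
    obtain ⟨t, ht, rfl⟩ := hx
    intro b
    have h1 := (ht.1 b)
    have h2 := hw.nonneg b
    exact ⟨mul_nonneg h2 h1.1, mul_le_of_le_one_right h2 h1.2⟩
  refine ⟨mass_add_mass_compl hw B x, fun a => ?_, ?_, fun a c hac => ?_⟩
  · unfold mass
    split_ifs with h
    · exact sub_nonneg.2 (hbd ⟨a, h⟩).2
    · exact (hbd _).1
  · obtain ⟨_, hreach⟩ := hV U ⟨hU, fun _ _ => Iff.rfl⟩
    refine ((finite_of_reachable hreach).union (F.finite_toSet.image Subtype.val)).subset ?_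
    rintro b ⟨hb, hne⟩
    rcases exists_isFree_or_mem hU hx hne with h | h
    · exact Or.inl ⟨hb, (hU.compl_mem_iff b).1 h⟩
    · obtain ⟨b', hb', h | h⟩ := h
      · exact absurd hb ((B.compl_mem_iff b).1 (h ▸ b'.2))
      · exact Or.inr ⟨b', hb', by rw [h, compl_involutive]⟩
  · by_contra! hcon
    have h1 : mass w B x cᶜ ≠ 0 := fun h => hcon.2 (by
      have := mass_add_mass_compl hw B x c
      linarith)
    obtain ⟨V, hVF, haV, hcV⟩ := exists_faceVertex hU (exists_isFree_or_mem hU hx hcon.1)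
      (exists_isFree_or_mem hU hx h1) fun e => hac.ne (compl_inj' e).symm
    obtain ⟨⟨_, hcoh⟩, _⟩ := hV V hVF
    exact hcoh a haV cᶜ hcV (by rw [compl_involutive]; exact hac.le)

theorem IsState.le {w : P → ℝ} {B : Dual P} {X : P → ℝ} (hX : IsState w B X) (a : P) :
    X a ≤ w a := by
  have := hX.add_compl a
  have := hX.nonneg aᶜ
  linarith

/-- Two states whose mixed coherence conditions hold lie in a common cube. -/
theorem exists_common_cube {w : P → ℝ} (hw : IsWeight w) (hw' : IsNondegenerate w) {B : Dual P}
    {X Y : P → ℝ} (hX : IsState w B X) (hY : IsState w B Y)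
    (hXY : ∀ a c, a < c → X a = 0 ∨ Y c = w c) :
    ∃ Q ∈ weightedCubes w B, ofMass B X ∈ Q ∧ ofMass B Y ∈ Q := by
  classical
  -- The free coordinates are those where `X` and `Y` are not both at `0` or both at the full
  -- weight.
  set G : Set B.1 := {b | (X (b : P)ᶜ ≠ 0 ∨ Y (b : P)ᶜ ≠ 0) ∧
    ¬ (X (b : P)ᶜ = w b ∧ Y (b : P)ᶜ = w b)} with hG
  have hGfin : G.Finite := by
    refine Set.Finite.of_finite_image (f := Subtype.val)
      ((hX.finite.union hY.finite).subset ?_) Subtype.val_injective.injOn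
    rintro _ ⟨b, hb, rfl⟩
    exact hb.1.imp (fun h => ⟨b.2, h⟩) (fun h => ⟨b.2, h⟩)
  set U := selectionOf B {b | X bᶜ = 0} with hU
  have hUmem : ∀ b ∈ B.1, b ∈ U ↔ X bᶜ = 0 := fun b hb => mem_selectionOf hb
  have hmem : ∀ Z, (Z = X ∨ Z = Y) → ofMass B Z ∈ diag w B '' unitFace B U hGfin.toFinset := by
    intro Z hZ
    have hZs : IsState w B Z := by rcases hZ with rfl | rfl <;> assumption
    have hZle : ∀ b : B.1, Z (b : P)ᶜ ≤ w b := fun b => by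
      rw [← hw.map_compl]; exact hZs.le _
    refine ⟨fun b => Z (b : P)ᶜ / w b, ⟨fun b => ⟨div_nonneg (hZs.nonneg _) (hw.nonneg _),
      div_le_one_of_le₀ (hZle b) (hw.nonneg _)⟩, fun b hb => ?_⟩, ?_⟩
    · rw [Set.Finite.mem_toFinset, hG, Set.mem_ofPred_eq] at hb
      simp only [rho, hUmem b b.2]
      split_ifs with h0
      · have hZ0 : Z (b : P)ᶜ = 0 := by
          rcases hZ with rfl | rfl
          · exact h0
          · by_contra hne
            have := hb
            simp only [hne, not_false_eq_true, ne_eq, or_true, true_and, not_not, h0] at this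
            exact hne (this.2.trans this.1.symm)
        simp [hZ0]
      · have h1 : X (b : P)ᶜ = w b ∧ Y (b : P)ᶜ = w b := by
          by_contra hne
          exact hb ⟨Or.inl h0, hne⟩
        have h2 : w b ≠ 0 := h1.1 ▸ h0
        rcases hZ with rfl | rfl
        · rw [h1.1, div_self h2]
        · rw [h1.2, div_self h2]
    · funext b
      simp only [diag, ofMass]
      by_cases h : w b = 0
      · have := hZle b
        have := hZs.nonneg (b : P)ᶜ
        rw [h, zero_mul]; linarith
      · field_simp
  have hbot : ∀ Z, IsState w B Z → Z ⊥ = 0 := fun Z hZ =>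
    le_antisymm (hw.map_bot ▸ hZ.le ⊥) (hZ.nonneg ⊥)
  refine ⟨_, ⟨U, hGfin.toFinset, isSelection_selectionOf _ _, fun V hV => ?_, rfl⟩,
    hmem X (Or.inl rfl), hmem Y (Or.inr rfl)⟩
  have hVU : ∀ b ∈ B.1,
      ¬ ((X bᶜ ≠ 0 ∨ Y bᶜ ≠ 0) ∧ ¬ (X bᶜ = w b ∧ Y bᶜ = w b)) → (b ∈ V ↔ b ∈ U) := by
    intro b hb h
    exact hV.2 ⟨b, hb⟩ (by rwa [Set.Finite.mem_toFinset])
  -- Except for the top, every element of a vertex has a share in `X` or in `Y`; non-degeneracy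
  -- enters here.
  have hpos : ∀ a ∈ V, X a = 0 → Y a = 0 → a = (⊥ : P)ᶜ := by
    intro a haV hXa hYa
    have hX1 := hX.add_compl a
    have hY1 := hY.add_compl a
    by_cases ha : a ∈ B.1
    · have h1 := (hVU a ha (fun h => h.2 ⟨by linarith, by linarith⟩)).1 haV
      rw [hUmem a ha] at h1
      by_contra hne
      have := hw' a ⟨fun h => B.2.2.bot_notMem (h ▸ ha), hne⟩
      linarith
    · have hc := (B.compl_mem_iff a).2 ha
      have h1 := hVU aᶜ hc (by simp [compl_involutive, hXa, hYa])
      rw [hUmem aᶜ hc, compl_involutive] at h1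
      exact absurd haV ((hV.1.compl_mem_iff a).1 (h1.2 hXa))
  have hbotV : ⊥ ∉ V := fun h => B.bot_ne_top (hpos ⊥ h (hbot X hX) (hbot Y hY))
  have hpos' : ∀ a ∈ V, ∀ c ∈ V, a ≤ cᶜ → X a ≠ 0 ∨ Y a ≠ 0 := by
    intro a ha c hc hac
    by_contra! h
    have h1 := hpos a ha h.1 h.2
    rw [h1] at hac
    have h2 : c ≤ ⊥ := by simpa [compl_involutive] using le_compl_comm' hac
    exact hbotV (le_bot_iff.1 h2 ▸ hc)
  have hcoh : IsCoherent V := by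
    intro a ha c hc hac
    have hlt : a < cᶜ := lt_of_le_of_ne hac fun h => (hV.1.compl_mem_iff c).1 (h ▸ ha) hc
    have hlt' : c < aᶜ := by simpa [compl_involutive] using compl_lt_compl' hlt
    have e1 := hX.add_compl a
    have e2 := hX.add_compl c
    have e3 := hY.add_compl a
    have e4 := hY.add_compl c
    have e5 := hw.map_compl a
    have e6 := hw.map_compl c
    have g1 := hXY a _ hlt
    have g2 := hXY c _ hlt'
    have g3 := hX.coherent a _ hlt
    have g4 := hY.coherent a _ hlt
    -- The shares of `a` and `c` come from `X` or `Y`: equal sources contradict the coherence of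
    -- that state, different ones contradict `hXY` for `a < cᶜ` or `c < aᶜ`.
    rcases hpos' a ha c hc hac with h1 | h1 <;>
    rcases hpos' c hc a ha (le_compl_comm' hac) with h2 | h2
    · exact h2 (by have := g3.resolve_left h1; linarith)
    · exact h2 (by have := g1.resolve_left h1; linarith)
    · exact h1 (by have := g2.resolve_left h2; linarith)
    · exact h2 (by have := g4.resolve_left h1; linarith)
  refine ⟨⟨hV.1, hcoh⟩, reachable_of_finite _ _ ?_⟩
  refine ((hX.finite.union hY.finite)).subset ?_
  rintro b ⟨hb, hbV⟩
  by_contra hcon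
  have h1 : X bᶜ = 0 := by by_contra h; exact hcon (Or.inl ⟨hb, h⟩)
  have h2 : Y bᶜ = 0 := by by_contra h; exact hcon (Or.inr ⟨hb, h⟩)
  exact hbV ((hVU b hb (by simp [h1, h2])).2 ((hUmem b hb).2 h1))

end Mass

/-! ### Lower bound: nested sets -/

section LowerBound

variable {P : Type*} [PocSet P]

/-- A nonzero term belongs to a free element, and distinct non-complementary free elements are not
nested; so at most one term survives. -/
theorem tsum_le_iSup_of_mem_cube (w : P → ℝ) {B : Dual P} {Q : Set (B.1 → ℝ)}
    (hQ : Q ∈ weightedCubes w B) {x y : B.1 → ℝ} (hx : x ∈ Q) (hy : y ∈ Q) {N : Set P}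
    (hN : IsNested N) (hN' : ∀ a ∈ N, aᶜ ∉ N) :
    ∑' a : N, ENNReal.ofReal |coord B x a - coord B y a| ≤
      ⨆ b : B.1, ENNReal.ofReal |x b - y b| := by
  obtain ⟨U, F, hU, hV, rfl⟩ := hQ
  have hfree : ∀ a, ENNReal.ofReal |coord B x a - coord B y a| ≠ 0 → IsFree B F a := by
    intro a ha
    refine isFree_of_mass_ne hx hy fun h => ha ?_
    rw [abs_coord_sub_coord w, h]
    simp
  by_cases h0 : ∃ a : N, ENNReal.ofReal |coord B x a - coord B y a| ≠ 0
  · obtain ⟨a, ha⟩ := h0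
    rw [tsum_eq_single a]
    · unfold coord
      split_ifs with h
      · exact le_iSup (fun b : B.1 => ENNReal.ofReal |x b - y b|) ⟨a, h⟩
      · exact le_iSup (fun b : B.1 => ENNReal.ofReal |x b - y b|) ⟨(a : P)ᶜ, _⟩
    · intro c hca
      by_contra hc
      exact not_nestedPair_of_isFree hU (fun V hVF => (hV V hVF).1.2) (hfree a ha) (hfree c hc)
        (fun h => hca (Subtype.ext h)) (fun h => hN' a a.2 (h ▸ c.2)) (hN a a.2 c c.2)
  · push Not at h0
    simp [h0]

theorem tsum_le_ellInfty (w : P → ℝ) (B : Dual P) (x y : B.1 → ℝ) {N : Set P}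
    (hN : IsNested N) (hN' : ∀ a ∈ N, aᶜ ∉ N) :
    ∑' a : N, ENNReal.ofReal |coord B x a - coord B y a| ≤ ellInfty w B x y := by
  refine le_quotientEDist (D := fun x y : B.1 → ℝ =>
    ∑' a : N, ENNReal.ofReal |coord B x a - coord B y a|) (fun x y z => ?_) (fun p q => ?_) x y
  · rw [← ENNReal.tsum_add]
    refine ENNReal.tsum_le_tsum fun a => ?_
    rw [← ENNReal.ofReal_add (abs_nonneg _) (abs_nonneg _)]
    exact ENNReal.ofReal_le_ofReal (abs_sub_le _ _ _)
  · unfold cubeEDist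
    split_ifs with h
    · exact tsum_le_iSup_of_mem_cube w p.1.2 p.2.2 (by rw [h]; exact q.2.2) hN hN'
    · exact le_top

theorem compl_notMem_separator {B : Dual P} {x y : B.1 → ℝ} {a : P} (ha : a ∈ separator B x y) :
    aᶜ ∉ separator B x y := by
  have h := compl_involutive a
  have h' := B.compl_mem_iff a
  by_cases haB : a ∈ B.1
  · simp only [separator, coord, haB, h', Set.mem_ofPred_eq, h] at ha ⊢
    simp at ha ⊢
    exact ha.le
  · simp only [separator, coord, haB, h', Set.mem_ofPred_eq, h] at ha ⊢
    simp at ha ⊢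
    exact ha.le

end LowerBound

/-! ### Upper bound: moving mass along minimal elements -/

section UpperBound

variable {P : Type*} [PocSet P]

theorem ellInfty_le_add {w : P → ℝ} {B : Dual P} {Q : Set (B.1 → ℝ)} (hQ : Q ∈ weightedCubes w B)
    {x x' : B.1 → ℝ} (hx : x ∈ Q) (hx' : x' ∈ Q) (y : B.1 → ℝ) :
    ellInfty w B x y ≤ (⨆ b : B.1, ENNReal.ofReal |x b - x' b|) + ellInfty w B x' y := by
  have := quotientEDist_le_add (cubeEDist w B)
    (fun p : Σ Q : weightedCubes w B, Q.1 => (p.2 : B.1 → ℝ)) ⟨⟨Q, hQ⟩, ⟨x, hx⟩⟩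
    ⟨⟨Q, hQ⟩, ⟨x', hx'⟩⟩ y
  simpa [cubeEDist, ellInfty] using this

theorem ellInfty_self {w : P → ℝ} {B : Dual P} {x : B.1 → ℝ} (hx : x ∈ weightedDual w B) :
    ellInfty w B x x = 0 := by
  obtain ⟨Q, hQ, hx⟩ := hx
  refine nonpos_iff_eq_zero.1 (sInf_le ⟨0, fun _ => ⟨⟨Q, hQ⟩, ⟨x, hx⟩⟩,
    fun _ => ⟨⟨Q, hQ⟩, ⟨x, hx⟩⟩, rfl, rfl, by simp, ?_⟩)
  simp [cubeEDist]

/-- The state reached from `X` by moving the mass `ε` from `a` to `aᶜ` for all `a ∈ M`. -/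
noncomputable def shift (X : P → ℝ) (M : Set P) (ε : ℝ) (a : P) : ℝ :=
  open Classical in if a ∈ M then X a - ε else if aᶜ ∈ M then X a + ε else X a

theorem IsState.finite_setOf_lt {w : P → ℝ} {B : Dual P} {X Y : P → ℝ} (hX : IsState w B X)
    (hY : IsState w B Y) : {a | Y a < X a}.Finite := by
  have h := hX.finite.union hY.finite
  refine (h.union (h.image (fun a => aᶜ))).subset fun a ha => ?_
  have key : ∀ b ∈ B.1, X bᶜ ≠ Y bᶜ → b ∈ {b | b ∈ B.1 ∧ X bᶜ ≠ 0} ∪ {b | b ∈ B.1 ∧ Y bᶜ ≠ 0} := by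
    intro b hb hne
    by_contra hcon
    simp only [Set.mem_union, Set.mem_ofPred_eq, hb, true_and, not_or, not_not, ne_eq] at hcon
    exact hne (hcon.1.trans hcon.2.symm)
  have ha : Y a < X a := ha
  by_cases haB : a ∈ B.1
  · refine Or.inl (key a haB fun e => ?_)
    have := hX.add_compl a
    have := hY.add_compl a
    linarith
  · exact Or.inr ⟨aᶜ, key _ ((B.compl_mem_iff a).2 haB) (by rw [compl_involutive]; exact ha.ne'),
      compl_involutive a⟩

/-- `X - Y` changes sign under complement, so `M` contains no complementary pair; the bound on `ε`
prevents overshooting `Y`. -/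
theorem shift_trichotomy {w : P → ℝ} {B : Dual P} {X Y : P → ℝ} (hX : IsState w B X)
    (hY : IsState w B Y) {M : Set P} {ε : ℝ} (hε : 0 < ε) (hM : ∀ a ∈ M, ε ≤ X a - Y a) (a : P) :
    (a ∈ M ∧ shift X M ε a = X a - ε ∧ shift X M ε aᶜ = X aᶜ + ε ∧
      Y a ≤ shift X M ε a ∧ shift X M ε aᶜ ≤ Y aᶜ) ∨
    (aᶜ ∈ M ∧ shift X M ε a = X a + ε ∧ shift X M ε aᶜ = X aᶜ - ε ∧
      shift X M ε a ≤ Y a ∧ Y aᶜ ≤ shift X M ε aᶜ) ∨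
    (a ∉ M ∧ aᶜ ∉ M ∧ shift X M ε a = X a ∧ shift X M ε aᶜ = X aᶜ) := by
  have e1 := hX.add_compl a
  have e2 := hY.add_compl a
  by_cases h1 : a ∈ M
  · have h3 := hM a h1
    have h2 : aᶜ ∉ M := fun h => by have := hM _ h; linarith
    left
    simp only [shift, h1, h2, compl_involutive, if_true, if_false, true_and]
    constructor <;> linarith
  · by_cases h2 : aᶜ ∈ M
    · have h3 := hM _ h2
      right; left
      simp only [shift, h1, h2, compl_involutive, if_true, if_false, true_and]
      constructor <;> linarith
    · right; right
      simp [shift, h1, h2, compl_involutive]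

/-- Moving from `X` towards `Y` along the minimal elements of the separator stays in a cube. -/
theorem shift_minimal {w : P → ℝ} (hw : IsWeight w) {B : Dual P} {X Y : P → ℝ}
    (hX : IsState w B X) (hY : IsState w B Y) {M : Set P} {ε : ℝ} (hε : 0 < ε)
    (hM : ∀ a ∈ M, ε ≤ X a - Y a) (hmin : ∀ a ∈ M, ∀ b, b < a → X b ≤ Y b) :
    IsState w B (shift X M ε) ∧ ∀ a c, a < c → X a = 0 ∨ shift X M ε c = w c := by
  have tri := shift_trichotomy hX hY hε hM
  -- If `X c = w c` and the shift lowers `c`, then `Y c < w c`, so `Y a = 0`; minimality of `c`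
  -- gives `X a ≤ Y a`, so `X a = 0`.
  have hXY : ∀ a c, a < c → X a = 0 ∨ shift X M ε c = w c := by
    intro a c hac
    by_contra! hcon
    have hXc := (hX.coherent a c hac).resolve_left hcon.1
    rcases tri c with ⟨hc, -⟩ | ⟨hc, e1, e2, e3, e4⟩ | ⟨-, -, e, -⟩
    · have hYa : Y a = 0 := (hY.coherent a c hac).resolve_right fun h => by
        have := hM c hc; linarith
      exact hcon.1 (le_antisymm (hYa ▸ hmin c hc a hac) (hX.nonneg a))
    · have := hY.le c; linarith
    · exact hcon.2 (e.trans hXc)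
  have hcomp : ∀ a, shift X M ε a + shift X M ε aᶜ = w a := by
    intro a
    have := hX.add_compl a
    rcases tri a with ⟨-, e1, e2, -⟩ | ⟨-, e1, e2, -⟩ | ⟨-, -, e1, e2⟩ <;> linarith
  refine ⟨⟨hcomp, fun a => ?_, ?_, fun a c hac => ?_⟩, hXY⟩
  · have := hX.nonneg a
    have := hY.nonneg a
    rcases tri a with ⟨-, e1, e2, e3, e4⟩ | ⟨-, e1, e2, -⟩ | ⟨-, -, e1, e2⟩ <;> linarith
  · refine (hX.finite.union hY.finite).subset ?_
    rintro b ⟨hb, hne⟩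
    have h1 := hX.nonneg bᶜ
    have h2 := hY.nonneg bᶜ
    rcases tri b with ⟨-, e1, e2, e3, e4⟩ | ⟨-, e1, e2, e3, e4⟩ | ⟨-, -, e1, e2⟩
    · exact Or.inr ⟨hb, by intro h; linarith⟩
    · exact Or.inl ⟨hb, by intro h; linarith⟩
    · exact Or.inl ⟨hb, by rwa [← e2]⟩
  -- By `hXY` for `a < c` and `cᶜ < aᶜ`, a failure forces `X a = 0` and `X c = w c`. Both shares
  -- have then moved towards `Y`, so `Y` itself fails coherence at `a < c`.
  · by_contra! hcon
    have hXa : X a = 0 := (hXY a c hac).resolve_right hcon.2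
    have hXc : X c = w c := by
      have h1 := hX.add_compl c
      have h2 := hcomp a
      have h3 := hw.map_compl a
      rcases hXY _ _ (compl_lt_compl' hac) with h | h
      · linarith
      · exact absurd (by linarith) hcon.1
    have hYa : Y a ≠ 0 := by
      have h0 := hX.nonneg aᶜ
      have h1 := hY.nonneg a
      rcases tri a with ⟨-, e1, e2, e3, e4⟩ | ⟨-, e1, e2, e3, e4⟩ | ⟨-, -, e1, e2⟩
      · linarith
      · intro h; linarith
      · exact absurd (e1.trans hXa) hcon.1
    have hYc : Y c ≠ w c := by
      have h1 := hY.le c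
      rcases tri c with ⟨-, e1, e2, e3, e4⟩ | ⟨-, e1, e2, e3, e4⟩ | ⟨-, -, e1, e2⟩
      · intro h; linarith
      · linarith
      · exact absurd (e1.trans hXc) hcon.2
    exact (hY.coherent a c hac).elim hYa hYc

theorem exists_chain_ellInfty_le {w : P → ℝ} (hw : IsWeight w) (hw' : IsNondegenerate w)
    {B : Dual P} {Y : P → ℝ} (hY : IsState w B Y) (k : ℕ) :
    ∀ X : P → ℝ, IsState w B X → {a | Y a < X a}.ncard = k →
    ∃ N : Finset P, (∀ a ∈ N, Y a < X a) ∧ IsChain (· ≤ ·) (N : Set P) ∧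
      ellInfty w B (ofMass B X) (ofMass B Y) ≤ ENNReal.ofReal (∑ a ∈ N, (X a - Y a)) := by
  classical
  induction k using Nat.strong_induction_on with
  | _ k ih =>
  intro X hX hk
  have hfin := hX.finite_setOf_lt hY
  set S : Set P := {a | Y a < X a} with hS
  rcases S.eq_empty_or_nonempty with hemp | hne
  · have hle : ∀ a, X a ≤ Y a := fun a => not_lt.1 fun h => by
      have : a ∈ S := h
      rw [hemp] at this
      exact this
    have hXY : X = Y := funext fun a => by
      have h1 := hX.add_compl a
      have h2 := hY.add_compl a
      have h3 := hle a
      have h4 := hle aᶜ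
      linarith
    subst hXY
    obtain ⟨Q, hQ, hxQ, -⟩ := exists_common_cube hw hw' hX hX hX.coherent
    exact ⟨∅, by simp, by simp, by simp [ellInfty_self ⟨Q, hQ, hxQ⟩]⟩
  set M : Set P := {a | Minimal (· ∈ S) a} with hMdef
  have hMS : M ⊆ S := fun a ha => ha.1
  obtain ⟨m₀, hm₀⟩ : M.Nonempty := hfin.exists_minimal hne
  -- The least excess is the largest step that overshoots nowhere, and it removes `m` from the
  -- separator.
  obtain ⟨m, hm, hmle⟩ := Set.exists_min_image M (fun a => X a - Y a) (hfin.subset hMS) ⟨m₀, hm₀⟩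
  have hmS : Y m < X m := hMS hm
  set ε : ℝ := X m - Y m with hε
  have hε0 : 0 < ε := sub_pos.2 hmS
  have tri := shift_trichotomy hX hY hε0 hmle
  obtain ⟨hX', hXX'⟩ := shift_minimal hw hX hY hε0 hmle fun a ha b hba => by
    by_contra! hb
    exact hba.not_ge (ha.2 hb hba.le)
  set X' := shift X M ε with hX'def
  have hle : ∀ a, Y a < X' a → X' a ≤ X a := by
    intro a ha
    rcases tri a with ⟨-, e1, e2, e3, e4⟩ | ⟨-, e1, e2, e3, e4⟩ | ⟨-, -, e1, e2⟩ <;> linarith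
  have hsub : {a | Y a < X' a} ⊂ S := by
    refine (Set.ssubset_iff_of_subset fun a ha => lt_of_lt_of_le ha (hle a ha)).2 ⟨m, hmS, ?_⟩
    change ¬ Y m < X' m
    have : X' m = X m - ε := if_pos hm
    linarith
  obtain ⟨N, hNS, hN, hNle⟩ := ih _ (hk ▸ Set.ncard_lt_ncard hsub hfin) X' hX' rfl
  obtain ⟨Q, hQ, hxQ, hxQ'⟩ := exists_common_cube hw hw' hX hX' hXX'
  have hsup : (⨆ b : B.1, ENNReal.ofReal |ofMass B X b - ofMass B X' b|) ≤ ENNReal.ofReal ε := by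
    refine iSup_le fun b => ENNReal.ofReal_le_ofReal ?_
    change |X (b : P)ᶜ - X' (b : P)ᶜ| ≤ ε
    rw [abs_le]
    rcases tri b with ⟨-, e1, e2, -⟩ | ⟨-, e1, e2, -⟩ | ⟨-, -, e1, e2⟩ <;>
      constructor <;> linarith
  have hsum0 : 0 ≤ ∑ a ∈ N, (X' a - Y a) :=
    Finset.sum_nonneg fun a ha => (sub_pos.2 (hNS a ha)).le
  have hbound : ellInfty w B (ofMass B X) (ofMass B Y) ≤
      ENNReal.ofReal (ε + ∑ a ∈ N, (X' a - Y a)) := by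
    rw [ENNReal.ofReal_add hε0.le hsum0]
    exact (ellInfty_le_add hQ hxQ hxQ' _).trans (add_le_add hsup hNle)
  have hNX : ∀ a ∈ N, Y a < X a := fun a ha => (hNS a ha).trans_le (hle a (hNS a ha))
  by_cases hNM : ∃ a ∈ N, a ∈ M
  -- The excess of `a` drops by exactly `ε` and no other excess on `N` grows, so the same chain pays
  -- for the step.
  · obtain ⟨a, haN, haM⟩ := hNM
    refine ⟨N, hNX, hN, hbound.trans (ENNReal.ofReal_le_ofReal ?_)⟩
    have h1 := Finset.single_le_sum (f := fun a => X a - X' a)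
      (fun b hb => sub_nonneg.2 (hle b (hNS b hb))) haN
    have h2 : X' a = X a - ε := if_pos haM
    have h3 : ∑ b ∈ N, (X b - Y b) = ∑ b ∈ N, (X b - X' b) + ∑ b ∈ N, (X' b - Y b) := by
      rw [← Finset.sum_add_distrib]
      exact Finset.sum_congr rfl fun b _ => by ring
    simp only [h2] at h1
    linarith
  -- Otherwise a minimal element below the least element of `N` extends the chain, and its excess
  -- pays for the step.
  · obtain ⟨m₁, hm₁, hm₁N⟩ : ∃ m₁ ∈ M, ∀ a ∈ N, m₁ ≤ a := by
      rcases N.eq_empty_or_nonempty with rfl | hNe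
      · exact ⟨m, hm, by simp⟩
      · obtain ⟨n₀, hn₀⟩ := N.finite_toSet.exists_minimal hNe
        obtain ⟨m₁, hle₁, hm₁⟩ := hfin.exists_le_minimal (hNX n₀ hn₀.1)
        refine ⟨m₁, hm₁, fun a ha => hle₁.trans ?_⟩
        rcases hN.total hn₀.1 ha with h | h
        · exact h
        · exact hn₀.2 ha h
    have hnot : m₁ ∉ N := fun h => hNM ⟨m₁, h, hm₁⟩
    refine ⟨insert m₁ N, ?_, ?_, hbound.trans (ENNReal.ofReal_le_ofReal ?_)⟩
    · intro a ha
      rcases Finset.mem_insert.1 ha with rfl | ha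
      · exact hMS hm₁
      · exact hNX a ha
    · rw [Finset.coe_insert]
      exact hN.insert fun a ha _ => Or.inl (hm₁N a ha)
    · rw [Finset.sum_insert hnot]
      exact add_le_add (hmle m₁ hm₁)
        (Finset.sum_le_sum fun a ha => sub_le_sub_right (hle a (hNS a ha)) _)

end UpperBound

end PocSet

theorem mainTheorem10 {P : Type*} [PocSet P] (hP : PocSet.IsDiscrete P)
    (w : P → ℝ) (hw : PocSet.IsWeight w) (hw' : PocSet.IsNondegenerate w)
    (B : PocSet.Dual P) (x y : B.1 → ℝ)
    (hx : x ∈ PocSet.weightedDual w B) (hy : y ∈ PocSet.weightedDual w B) :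
    PocSet.ellInfty w B x y ≠ ⊤ ∧
    IsGreatest
      {s : ℝ≥0∞ | ∃ N : Set P, N ⊆ PocSet.separator B x y ∧ PocSet.IsNested N ∧
        s = ∑' a : N, ENNReal.ofReal |PocSet.coord B x a - PocSet.coord B y a|}
      (PocSet.ellInfty w B x y) := by
  obtain ⟨N, hNS, hN, hle⟩ := PocSet.exists_chain_ellInfty_le hw hw'
    (PocSet.isState_mass hw hy) _ _ (PocSet.isState_mass hw hx) rfl
  rw [PocSet.ofMass_mass, PocSet.ofMass_mass] at hle
  have hlower : ∀ N ⊆ PocSet.separator B x y, PocSet.IsNested N →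
      ∑' a : N, ENNReal.ofReal |PocSet.coord B x a - PocSet.coord B y a| ≤
        PocSet.ellInfty w B x y := fun N hN hN' => PocSet.tsum_le_ellInfty w B x y hN'
    fun a ha ha' => PocSet.compl_notMem_separator (hN ha) (hN ha')
  have hNsep : (N : Set P) ⊆ PocSet.separator B x y := by
    rw [PocSet.separator_eq w]
    exact hNS
  have hNn : PocSet.IsNested (N : Set P) := by
    intro a ha b hb
    rcases hN.total ha hb with h | h
    · exact Or.inl h
    · exact Or.inr (Or.inr (Or.inr (PocSet.compl_antitone _ _ h)))
  refine ⟨ne_top_of_le_ne_top ENNReal.ofReal_ne_top hle, ⟨N, hNsep, hNn, ?_⟩, ?_⟩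
  · refine le_antisymm (hle.trans_eq ?_) (hlower N hNsep hNn)
    rw [ENNReal.ofReal_sum_of_nonneg fun a ha => sub_nonneg.2 (hNS a ha).le]
    refine Eq.trans ?_ (Finset.tsum_subtype N
      fun a => ENNReal.ofReal |PocSet.coord B x a - PocSet.coord B y a|).symm
    refine Finset.sum_congr rfl fun a ha => ?_
    rw [PocSet.abs_coord_sub_coord w, abs_of_nonneg (sub_nonneg.2 (hNS a ha).le)]
  · rintro s ⟨N, h1, h2, rfl⟩
    exact hlower N h1 h2
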